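/- Let $\Omega$ be a compact metric space with its Borel $\sigma$-algebra, let $T\colon\Omega\to\Omega$ be a measurable invertible map, let $\nu$ be a $T$-invariant ergodic Borel probability measure on $\Omega$, and let $\psi\in L^2(\Omega,\nu)$ be complex valued. Let $\mathbf T=\mathbf R/\mathbf Z$ with Lebesgue measure $d\lambda$ of total mass one, and for $\omega\in\Omega$, $n\ge 1$, $\lambda\in\mathbf T$ put $$S_n^\omega(\lambda):=\sum_{k=0}^{n-1}e^{2\pi i\lambda k}\,\psi(T^k\omega).$$ Let $U\phi:=\phi\circ T$ be the associated unitary operator on $L^2(\Omega,\nu)$, and let $\mu_\psi$ be the spectral measure of $\psi$, i.e. the unique finite positive Borel measure on $\mathbf T$ with $\int_{\mathbf T}e^{-2\pi i n x}\,d\mu_\psi(x)=(U^n\psi,\psi)=\int_\Omega (U^n\psi)\,\overline{\psi}\,d\nu$ for all $n\in\mathbf Z$. Then for $\nu$-a.e. $\omega\in\Omega$ the measures $n^{-1}|S_n^\omega(\lambda)|^2\,d\lambda$ converge weakly to $\mu_\psi$ as $n\to\infty$. If moreover $(\Omega,T,\nu)$ is uniquely ergodic, i.e. $T$ is continuous and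 $\nu$ is the only $T$-invariant Borel probability measure on $\Omega$, and $\psi$ is continuous, then the convergence holds for every $\omega\in\Omega$. -/

import Mathlib

open MeasureTheory Filter Topology
open scoped ENNReal InnerProductSpace

noncomputable section

namespace TwistedWalk

/-! ### Spectral measures of unitary operators -/

section SpectralMeasure

variable {H : Type*} [NormedAddCommGroup H] [InnerProductSpace ℂ H]

/-- `μ` is the spectral measure of `ψ` for the unitary operator `U`: a finite positive Borel
measure on the circle `ℝ/ℤ` with `∫ e^{-2πinx} dμ(x) = (U^n ψ, ψ)` for every integer `n`.
The inner product `(·,·)` is linear in its first argument; Mathlib's `⟪x, y⟫_ℂ` is linear in `y`,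
so that `(U^n ψ, ψ)` is `⟪ψ, U^n ψ⟫_ℂ`. -/
def IsSpectralMeasure (U : H ≃ₗᵢ[ℂ] H) (ψ : H) (μ : FiniteMeasure UnitAddCircle) : Prop :=
  ∀ n : ℤ, ∫ x, fourier (-n) x ∂(μ : Measure UnitAddCircle) = ⟪ψ, (U ^ n) ψ⟫_ℂ

/-- Integration against a finite measure on the circle, as a functional on `C(ℝ/ℤ, ℂ)`. -/
def integralFunctional (μ : FiniteMeasure UnitAddCircle) : C(UnitAddCircle, ℂ) →L[ℂ] ℂ :=
  LinearMap.mkContinuous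
    { toFun := fun f => ∫ x, f x ∂(μ : Measure UnitAddCircle)
      map_add' := fun f g => integral_add
        (f.continuous.integrable_of_hasCompactSupport (HasCompactSupport.of_compactSpace _))
        (g.continuous.integrable_of_hasCompactSupport (HasCompactSupport.of_compactSpace _))
      map_smul' := fun c f => integral_const_mul c _ }
    ((μ : Measure UnitAddCircle).real Set.univ)
    (fun f => by
      rw [mul_comm]
      exact norm_integral_le_of_norm_le_const (Eventually.of_forall fun x => f.norm_coe_le_norm x))

theorem IsSpectralMeasure.unique {U : H ≃ₗᵢ[ℂ] H} {ψ : H} {μ μ' : FiniteMeasure UnitAddCircle}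
    (h : IsSpectralMeasure U ψ μ) (h' : IsSpectralMeasure U ψ μ') : μ = μ' := by
  have key : integralFunctional μ = integralFunctional μ' := by
    apply ContinuousLinearMap.ext_on (s := Set.range (@fourier 1))
    · exact (Submodule.dense_iff_topologicalClosure_eq_top).2 span_fourier_closure_eq_top
    · rintro _ ⟨n, rfl⟩
      have h1 := h (-n)
      rw [← h' (-n), neg_neg] at h1
      exact h1
  apply Subtype.ext
  change (μ : Measure UnitAddCircle) = (μ' : Measure UnitAddCircle)
  apply ext_of_forall_integral_eq_of_IsFiniteMeasure
  intro f
  have := congrArg (fun L => L ⟨fun x => (f x : ℂ), by fun_prop⟩) key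
  change ∫ x, (f x : ℂ) ∂(μ : Measure UnitAddCircle) = ∫ x, (f x : ℂ) ∂(μ' : Measure UnitAddCircle)
    at this
  rw [integral_complex_ofReal, integral_complex_ofReal] at this
  exact_mod_cast this

variable [CompleteSpace H]

open scoped ComplexOrder in
theorem exists_isSpectralMeasure (U : H ≃ₗᵢ[ℂ] H) (ψ : H) :
    ∃ μ : FiniteMeasure UnitAddCircle, IsSpectralMeasure U ψ μ := by
  set u : unitary (H →L[ℂ] H) := Unitary.linearIsometryEquiv.symm U with hu
  have hun : IsStarNormal (u : H →L[ℂ] H) := inferInstance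
  have hcirc : ∀ z : spectrum ℂ (u : H →L[ℂ] H), (z : ℂ) ∈ Metric.sphere (0 : ℂ) 1 := fun z =>
    Unitary.spectrum_subset_circle u z.2
  -- the point of the spectrum `e^{-2πix}` corresponds to the point `x` of the circle
  let c : C(spectrum ℂ (u : H →L[ℂ] H), Circle) :=
    ⟨fun z => (⟨z, hcirc z⟩ : Circle), by
      exact Continuous.subtype_mk continuous_subtype_val _⟩
  let g : C(spectrum ℂ (u : H →L[ℂ] H), UnitAddCircle) :=
    ⟨fun z => (AddCircle.homeomorphCircle one_ne_zero).symm (c z)⁻¹, by fun_prop⟩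
  have hg : ∀ (n : ℤ) z, fourier (-n) (g z) = ((c z ^ n : Circle) : ℂ) := by
    intro n z
    have h1 : AddCircle.toCircle (g z) = (c z)⁻¹ := by
      rw [← AddCircle.homeomorphCircle_apply one_ne_zero]
      exact Homeomorph.apply_symm_apply _ _
    rw [fourier_apply, AddCircle.toCircle_zsmul, h1]
    simp
  let Φ := cfcHom (R := ℂ) hun
  let A : C(UnitAddCircle, ℂ) →ₗ[ℂ] ℂ :=
    { toFun := fun f => ⟪ψ, Φ (f.comp g) ψ⟫_ℂ
      map_add' := fun f f' => by
        rw [ContinuousMap.add_comp, map_add, add_apply, inner_add_right]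
      map_smul' := fun a f => by
        rw [ContinuousMap.smul_comp, map_smul, smul_apply, inner_smul_right]; rfl }
  let R : C(UnitAddCircle, ℝ) → C(UnitAddCircle, ℂ) := fun f => ⟨fun x => (f x : ℂ), by fun_prop⟩
  have hpos : ∀ f : C(UnitAddCircle, ℝ), 0 ≤ f → 0 ≤ A (R f) := by
    intro f hf
    have h1 : (0 : C(spectrum ℂ (u : H →L[ℂ] H), ℂ)) ≤ (R f).comp g := by
      intro z
      simpa [R] using hf (g z)
    have h2 : 0 ≤ Φ ((R f).comp g) := (cfcHom_nonneg_iff hun).2 h1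
    exact ((ContinuousLinearMap.nonneg_iff_isPositive _).1 h2).inner_nonneg_right ψ
  let L : CompactlySupportedContinuousMap UnitAddCircle ℝ →ₚ[ℝ] ℝ := PositiveLinearMap.mk₀
    { toFun := fun f => (A (R f.toContinuousMap)).re
      map_add' := fun f f' => by
        rw [← Complex.add_re, ← map_add]
        congr 2
        ext x; simp [R]
      map_smul' := fun a f => by
        have : R (a • f).toContinuousMap = (a : ℂ) • R f.toContinuousMap := by
          ext x; simp [R]
        simp [this] }
    (fun f hf => (Complex.le_def.1 (hpos f.toContinuousMap (fun x => hf x))).1)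
  have hfin : IsFiniteMeasure (RealRMK.rieszMeasure L) := by infer_instance
  have hint : ∀ f : C(UnitAddCircle, ℝ),
      ((∫ x, f x ∂(RealRMK.rieszMeasure L) : ℝ) : ℂ) = A (R f) := by
    intro f
    have h1 : ∫ x, f x ∂(RealRMK.rieszMeasure L) = (A (R f)).re :=
      RealRMK.integral_rieszMeasure L (CompactlySupportedContinuousMap.continuousMapEquiv f)
    have h2 : star (Φ ((R f).comp g)) = Φ ((R f).comp g) := by
      rw [← map_star]
      congr 1
      ext z
      simp [R]
    have h3 : (starRingEnd ℂ) (A (R f)) = A (R f) := by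
      change (starRingEnd ℂ) ⟪ψ, Φ ((R f).comp g) ψ⟫_ℂ = ⟪ψ, Φ ((R f).comp g) ψ⟫_ℂ
      rw [inner_conj_symm, ← ContinuousLinearMap.adjoint_inner_right,
        ← ContinuousLinearMap.star_eq_adjoint, h2]
    rw [h1]
    exact Complex.conj_eq_iff_re.1 h3
  refine ⟨⟨RealRMK.rieszMeasure L, hfin⟩, fun n => ?_⟩
  have hΦ : Φ ((fourier (-n)).comp g) = ((u ^ n : unitary (H →L[ℂ] H)) : H →L[ℂ] H) := by
    have hid : Φ ((ContinuousMap.id ℂ).restrict (spectrum ℂ (u : H →L[ℂ] H))) = u := cfcHom_id hun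
    obtain ⟨m, rfl | rfl⟩ := n.eq_nat_or_neg
    · have h1 : (fourier (-(m : ℤ))).comp g =
          ((ContinuousMap.id ℂ).restrict (spectrum ℂ (u : H →L[ℂ] H))) ^ m := by
        ext z
        rw [ContinuousMap.comp_apply, hg]
        simp [c]
        rfl
      rw [h1, map_pow, hid, zpow_natCast]
      rfl
    · have h1 : (fourier (- -(m : ℤ))).comp g =
          star (((ContinuousMap.id ℂ).restrict (spectrum ℂ (u : H →L[ℂ] H))) ^ m) := by
        ext z
        rw [ContinuousMap.comp_apply, hg, zpow_neg, Circle.coe_inv_eq_conj]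
        simp [c]
        rfl
      rw [h1, map_star, map_pow, hid, zpow_neg, zpow_natCast]
      rfl
  have hU : (U ^ n) ψ = Φ ((fourier (-n)).comp g) ψ := by
    have h1 : Unitary.linearIsometryEquiv u = U := by simp [hu]
    rw [hΦ, ← h1, ← map_zpow]
    rfl
  let F : C(UnitAddCircle, ℂ) := fourier (-n)
  let f1 : C(UnitAddCircle, ℝ) := ⟨fun x => (F x).re, by fun_prop⟩
  let f2 : C(UnitAddCircle, ℝ) := ⟨fun x => (F x).im, by fun_prop⟩
  have hF : F = R f1 + Complex.I • R f2 := by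
    ext x
    change F x = ((F x).re : ℂ) + Complex.I * ((F x).im : ℂ)
    rw [mul_comm, Complex.re_add_im]
  have hI : Integrable (fun x => F x) (RealRMK.rieszMeasure L) :=
    F.continuous.integrable_of_hasCompactSupport (HasCompactSupport.of_compactSpace _)
  rw [hU]
  change ∫ x, F x ∂(RealRMK.rieszMeasure L) = A F
  have h4 := integral_re_add_im hI
  rw [← h4, hF, map_add, map_smul, ← hint, ← hint, smul_eq_mul, mul_comm Complex.I, ← hF]
  rfl

/-- The spectral measure `μ_ψ` of `ψ` for the unitary operator `U`. -/
def spectralMeasure (U : H ≃ₗᵢ[ℂ] H) (ψ : H) : FiniteMeasure UnitAddCircle :=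
  Classical.choose (exists_isSpectralMeasure U ψ)

theorem isSpectralMeasure_spectralMeasure (U : H ≃ₗᵢ[ℂ] H) (ψ : H) :
    IsSpectralMeasure U ψ (spectralMeasure U ψ) :=
  Classical.choose_spec (exists_isSpectralMeasure U ψ)

end SpectralMeasure

/-! ### Dynamical systems -/

section Dynamics

variable {Ω : Type*} [MeasurableSpace Ω]

/-- The unitary operator `U φ = φ ∘ T` on `L²(Ω, ν)`. -/
def koopman (T : Ω ≃ᵐ Ω) (ν : Measure Ω) (hT : MeasurePreserving T ν ν) :
    Lp ℂ 2 ν ≃ₗᵢ[ℂ] Lp ℂ 2 ν :=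
  LinearIsometryEquiv.ofSurjective (Lp.compMeasurePreservingₗᵢ ℂ T hT) (fun φ => by
    refine ⟨Lp.compMeasurePreserving T.symm (hT.symm T) φ, ?_⟩
    change Lp.compMeasurePreserving T hT (Lp.compMeasurePreserving T.symm (hT.symm T) φ) = φ
    apply Lp.ext
    have h1 := Lp.coeFn_compMeasurePreserving
      (Lp.compMeasurePreserving T.symm (hT.symm T) φ) hT
    have h2 := hT.quasiMeasurePreserving.ae_eq_comp
      (Lp.coeFn_compMeasurePreserving φ (hT.symm T))
    refine h1.trans (h2.trans (Eventually.of_forall fun x => ?_))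
    simp)

/-- The topological dynamical system `(Ω, T)` with invariant probability measure `ν` is uniquely
ergodic: `T` is continuous and `ν` is its only invariant Borel probability measure. -/
structure IsUniquelyErgodic [TopologicalSpace Ω] (T : Ω → Ω) (ν : Measure Ω) : Prop where
  continuous : Continuous T
  measurePreserving : MeasurePreserving T ν ν
  eq_of_invariant : ∀ ρ : Measure Ω, IsProbabilityMeasure ρ → MeasurePreserving T ρ ρ → ρ = ν

end Dynamics

/-! ### Twisted walks -/

section Walk

variable {Ω : Type*}

/-- The twisted walk `S_n^ω(λ) = ∑_{k<n} e^{2πiλk} ψ(T^k ω)`. -/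
def twistedSum (T : Ω → Ω) (ψ : Ω → ℂ) (ω : Ω) (n : ℕ) (l : UnitAddCircle) : ℂ :=
  ∑ k ∈ Finset.range n, fourier (k : ℤ) l * ψ (T^[k] ω)

theorem continuous_twistedSum (T : Ω → Ω) (ψ : Ω → ℂ) (ω : Ω) (n : ℕ) :
    Continuous (twistedSum T ψ ω n) := by
  unfold twistedSum
  exact continuous_finsetSum _ fun k _ => (fourier (k : ℤ)).continuous.mul continuous_const

/-- The finite measure `n⁻¹ |S_n^ω(λ)|² dλ` on the circle `ℝ/ℤ`, where `dλ` is Lebesgue measure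
(of total mass one). For `n = 0` it is the zero measure. -/
def periodogram (T : Ω → Ω) (ψ : Ω → ℂ) (ω : Ω) (n : ℕ) : FiniteMeasure UnitAddCircle :=
  ⟨(volume : Measure UnitAddCircle).withDensity
      (fun l => ENNReal.ofReal ((n : ℝ)⁻¹ * ‖twistedSum T ψ ω n l‖ ^ 2)), by
    have h : Continuous fun l => (n : ℝ)⁻¹ * ‖twistedSum T ψ ω n l‖ ^ 2 := by
      have := continuous_twistedSum T ψ ω n
      fun_prop
    exact isFiniteMeasure_withDensity_ofReal
      (h.integrable_of_hasCompactSupport (HasCompactSupport.of_compactSpace _)).2⟩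

end Walk

end TwistedWalk

end

/-!
The Fourier coefficient of index `m ≥ 0` of `n⁻¹ |S_n^ω(λ)|² dλ` is, up to `m` missing terms,
the Birkhoff average at `ω` of `y ↦ ψ(T^m y) · conj ψ(y)`, while that of `μ_ψ` is the integral
`(U^m ψ, ψ)` of the same function. Fourier coefficients determine weak convergence on the circle,
because trigonometric polynomials are dense and the total masses stay bounded, so both claims are
ergodic theorems for these countably many functions.

Almost everywhere convergence comes from Garsia's argument: with `M_n` the maximum of the first
Birkhoff sums of `f`, the difference `M_{n+1} - M_n ∘ T = max (-M_n ∘ T) f` has nonnegative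
integral and tends to `f` where the sums are unbounded above, so by ergodicity `∫ f < 0` forces
them to be bounded above almost everywhere. Under unique ergodicity, every cluster point of the
empirical measures of an orbit is an invariant measure, hence equal to `ν`.
-/

noncomputable section

namespace TwistedWalk

theorem tendsto_of_forall_approx {ι E : Type*} [PseudoMetricSpace E] {l : Filter ι} {u : ι → E}
    {a : E} (h : ∀ ε > 0, ∃ v : ι → E, ∃ b, Tendsto v l (𝓝 b) ∧ dist b a < ε ∧
      ∀ᶠ i in l, dist (u i) (v i) < ε) :
    Tendsto u l (𝓝 a) := by
  rw [Metric.tendsto_nhds]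
  intro ε hε
  obtain ⟨v, b, hv, hb, huv⟩ := h (ε / 3) (by positivity)
  filter_upwards [huv, Metric.tendsto_nhds.1 hv (ε / 3) (by positivity)] with i hui hvi
  linarith [dist_triangle4 (u i) (v i) b a]

theorem nullMeasurableSet_bddAbove_range {α ι : Type*} [Countable ι] [MeasurableSpace α]
    {μ : Measure α} {f : ι → α → ℝ} (hf : ∀ i, AEMeasurable (f i) μ) :
    NullMeasurableSet {x | BddAbove (Set.range fun i => f i x)} μ := by
  refine (measurableSet_bddAbove_range fun i => (hf i).measurable_mk).nullMeasurableSet.congr ?_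
  filter_upwards [ae_all_iff.2 fun i => (hf i).ae_eq_mk] with x hx
  exact congrArg (fun u : ι → ℝ => BddAbove (Set.range u)) (funext fun i => (hx i).symm)

section Birkhoff

variable {α : Type*} {T : α → α} {f : α → ℝ}

/-- The maximum of the Birkhoff sums of `f` over the times `0 ≤ k ≤ n`, the maximal function of
Garsia's argument. Time `0` is included, so it is nonnegative. -/
def birkhoffMax (T : α → α) (f : α → ℝ) (n : ℕ) (x : α) : ℝ :=
  partialSups (fun k => birkhoffSum T f k x) n

theorem birkhoffMax_zero (T : α → α) (f : α → ℝ) (x : α) : birkhoffMax T f 0 x = 0 := by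
  simp [birkhoffMax]

theorem birkhoffMax_mono (T : α → α) (f : α → ℝ) (x : α) : Monotone (birkhoffMax T f · x) :=
  (partialSups _).monotone

theorem birkhoffMax_succ (T : α → α) (f : α → ℝ) (n : ℕ) (x : α) :
    birkhoffMax T f (n + 1) x = max 0 (f x + birkhoffMax T f n (T x)) := by
  have hlast (n : ℕ) (y : α) :
      birkhoffMax T f (n + 1) y = max (birkhoffMax T f n y) (birkhoffSum T f (n + 1) y) :=
    partialSups_add_one _ n
  induction n with
  | zero => rw [hlast, birkhoffMax_zero, birkhoffMax_zero, zero_add, birkhoffSum_one, add_zero]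
  | succ n ih =>
    rw [hlast, ih, hlast n, max_assoc, birkhoffSum_succ', max_add_add_left]

theorem birkhoffMax_succ_sub_comp (T : α → α) (f : α → ℝ) (n : ℕ) (x : α) :
    birkhoffMax T f (n + 1) x - birkhoffMax T f n (T x) = max (-birkhoffMax T f n (T x)) (f x) := by
  rw [birkhoffMax_succ, ← max_sub_sub_right, zero_sub, add_sub_cancel_right]

theorem abs_birkhoffMax_succ_sub_comp_le (T : α → α) (f : α → ℝ) (n : ℕ) (x : α) :
    |birkhoffMax T f (n + 1) x - birkhoffMax T f n (T x)| ≤ |f x| := by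
  have hnonneg : 0 ≤ birkhoffMax T f n (T x) :=
    (birkhoffMax_zero T f (T x)).symm.trans_le (birkhoffMax_mono T f (T x) n.zero_le)
  rw [birkhoffMax_succ_sub_comp, abs_le]
  grind

theorem tendsto_birkhoffMax_atTop {x : α}
    (hx : ¬ BddAbove (Set.range fun n => birkhoffSum T f n x)) :
    Tendsto (birkhoffMax T f · x) atTop atTop :=
  tendsto_atTop_atTop_of_monotone' (birkhoffMax_mono T f x)
    (bddAbove_range_partialSups.not.2 hx)

theorem bddAbove_range_birkhoffSum_comp_iff (T : α → α) (f : α → ℝ) (x : α) :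
    BddAbove (Set.range fun n => birkhoffSum T f n (T x)) ↔
      BddAbove (Set.range fun n => birkhoffSum T f n x) := by
  constructor
  · rintro ⟨C, hC⟩
    refine ⟨max 0 (f x + C), Set.forall_mem_range.2 fun n => ?_⟩
    cases n with
    | zero => simp
    | succ n =>
      rw [birkhoffSum_succ']
      exact le_max_of_le_right (add_le_add_right (hC ⟨n, rfl⟩) _)
  · rintro ⟨C, hC⟩
    refine ⟨C - f x, Set.forall_mem_range.2 fun n => ?_⟩
    rw [le_sub_iff_add_le', ← birkhoffSum_succ']
    exact hC ⟨n + 1, rfl⟩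

variable {E : Type*} [NormedAddCommGroup E]

theorem norm_birkhoffAverage_le [NormedSpace ℝ E] (T : α → α) (f : α → E) (n : ℕ) (x : α) :
    ‖birkhoffAverage ℝ T f n x‖ ≤ birkhoffAverage ℝ T (‖f ·‖) n x := by
  rw [birkhoffAverage, norm_smul, birkhoffAverage, Real.norm_of_nonneg (by positivity), smul_eq_mul]
  gcongr
  exact norm_sum_le _ _

variable [MeasurableSpace α] {μ : Measure α}

theorem integrable_birkhoffSum (hT : MeasurePreserving T μ μ) {f : α → E} (hf : Integrable f μ)
    (n : ℕ) : Integrable (birkhoffSum T f n) μ :=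
  integrable_finsetSum _ fun k _ => (hT.iterate k).integrable_comp_of_integrable hf

theorem integrable_birkhoffMax (hT : MeasurePreserving T μ μ) (hf : Integrable f μ) (n : ℕ) :
    Integrable (birkhoffMax T f n) μ := by
  induction n with
  | zero => simp [funext (birkhoffMax_zero T f)]
  | succ n ih =>
    rw [funext (birkhoffMax_succ T f n)]
    exact (integrable_zero α ℝ μ).sup (hf.add (hT.integrable_comp_of_integrable ih))

theorem integral_comp_of_measurePreserving [NormedSpace ℝ E] {β : Type*} [MeasurableSpace β]
    {ν : Measure β} {g : α → β} (hg : MeasurePreserving g μ ν) {f : β → E}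
    (hf : AEStronglyMeasurable f ν) : ∫ x, f (g x) ∂μ = ∫ y, f y ∂ν := by
  rw [← integral_map hg.aemeasurable (hg.map_eq.symm ▸ hf), hg.map_eq]

theorem integral_birkhoffMax_succ_sub_comp_nonneg (hT : MeasurePreserving T μ μ)
    (hf : Integrable f μ) (n : ℕ) :
    0 ≤ ∫ x, (birkhoffMax T f (n + 1) x - birkhoffMax T f n (T x)) ∂μ := by
  have hint := integrable_birkhoffMax hT hf
  have hcomp : Integrable (fun x => birkhoffMax T f n (T x)) μ :=
    hT.integrable_comp_of_integrable (hint n)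
  rw [integral_sub (hint _) hcomp,
    integral_comp_of_measurePreserving hT (hint n).aestronglyMeasurable, sub_nonneg]
  exact integral_mono (hint n) (hint (n + 1)) fun x => birkhoffMax_mono T f x n.le_succ

theorem integral_nonneg_of_ae_not_bddAbove_birkhoffSum (hT : MeasurePreserving T μ μ)
    (hf : Integrable f μ) (h : ∀ᵐ x ∂μ, ¬ BddAbove (Set.range fun n => birkhoffSum T f n x)) :
    0 ≤ ∫ x, f x ∂μ := by
  have hint := integrable_birkhoffMax hT hf
  refine ge_of_tendsto' (tendsto_integral_of_dominated_convergence (fun x => |f x|)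
    (fun n => ((hint (n + 1)).sub (hT.integrable_comp_of_integrable (hint n))).aestronglyMeasurable)
    hf.abs (fun n => .of_forall (abs_birkhoffMax_succ_sub_comp_le T f n)) ?_)
    (integral_birkhoffMax_succ_sub_comp_nonneg hT hf)
  filter_upwards [h] with x hx
  rw [← bddAbove_range_birkhoffSum_comp_iff] at hx
  refine tendsto_const_nhds.congr' ?_
  filter_upwards [(tendsto_birkhoffMax_atTop hx).eventually_ge_atTop (-f x)] with n hn
  exact ((birkhoffMax_succ_sub_comp T f n x).trans (max_eq_right (by linarith))).symm

theorem ae_bddAbove_birkhoffSum (hT : Ergodic T μ) (hf : Integrable f μ)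
    (hneg : ∫ x, f x ∂μ < 0) :
    ∀ᵐ x ∂μ, BddAbove (Set.range fun n => birkhoffSum T f n x) :=
  (hT.quasiErgodic.ae_mem_or_ae_notMem₀
    (nullMeasurableSet_bddAbove_range fun n =>
      (integrable_birkhoffSum hT.toMeasurePreserving hf n).aemeasurable)
    (.of_forall fun x => propext (bddAbove_range_birkhoffSum_comp_iff T f x))).resolve_right
    fun h => hneg.not_ge <|
      integral_nonneg_of_ae_not_bddAbove_birkhoffSum hT.toMeasurePreserving hf h

theorem dist_integral_le_integral_norm_sub [NormedSpace ℝ E] {f g : α → E} (hf : Integrable f μ)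
    (hg : Integrable g μ) : dist (∫ x, f x ∂μ) (∫ x, g x ∂μ) ≤ ∫ x, ‖f x - g x‖ ∂μ := by
  rw [dist_eq_norm, ← integral_sub hf hg]
  exact norm_integral_le_integral_norm _

variable [IsProbabilityMeasure μ]

theorem ae_eventually_birkhoffAverage_lt (hT : Ergodic T μ) (hf : Integrable f μ) {c : ℝ}
    (hc : ∫ x, f x ∂μ < c) :
    ∀ᵐ x ∂μ, ∀ᶠ n : ℕ in atTop, birkhoffAverage ℝ T f n x < c := by
  obtain ⟨b, hb, hbc⟩ := exists_between hc
  have hneg : ∫ x, (f x - b) ∂μ < 0 := by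
    rw [integral_sub hf (integrable_const b)]
    simpa using hb
  filter_upwards [ae_bddAbove_birkhoffSum hT (hf.sub (integrable_const b)) hneg] with x ⟨C, hC⟩
  have hsmall : ∀ᶠ n : ℕ in atTop, C / n < c - b :=
    (tendsto_const_div_atTop_nhds_zero_nat C).eventually_lt_const (sub_pos.2 hbc)
  filter_upwards [hsmall, eventually_gt_atTop 0] with n hn hn0
  have hsum : birkhoffSum T f n x - n * b ≤ C := by
    simpa [birkhoffSum, Finset.sum_sub_distrib] using hC ⟨n, rfl⟩
  have hpos : (0 : ℝ) < n := Nat.cast_pos.2 hn0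
  rw [div_lt_iff₀ hpos] at hn
  rw [birkhoffAverage, smul_eq_mul, inv_mul_lt_iff₀ hpos]
  linarith

theorem ae_tendsto_birkhoffAverage_real (hT : Ergodic T μ) (hf : Integrable f μ) :
    ∀ᵐ x ∂μ, Tendsto (birkhoffAverage ℝ T f · x) atTop (𝓝 (∫ x, f x ∂μ)) := by
  have hupper : ∀ᵐ x ∂μ, ∀ j : ℕ, ∀ᶠ n : ℕ in atTop,
      birkhoffAverage ℝ T f n x < ∫ x, f x ∂μ + 1 / ((j : ℝ) + 1) :=
    ae_all_iff.2 fun j => ae_eventually_birkhoffAverage_lt hT hf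
      (lt_add_of_pos_right _ Nat.one_div_pos_of_nat)
  have hlower : ∀ᵐ x ∂μ, ∀ j : ℕ, ∀ᶠ n : ℕ in atTop,
      birkhoffAverage ℝ T (-f) n x < ∫ x, (-f) x ∂μ + 1 / ((j : ℝ) + 1) :=
    ae_all_iff.2 fun j => ae_eventually_birkhoffAverage_lt hT hf.neg
      (lt_add_of_pos_right _ Nat.one_div_pos_of_nat)
  filter_upwards [hupper, hlower] with x hxu hxl
  rw [Metric.tendsto_nhds]
  intro ε hε
  obtain ⟨j, hj⟩ := exists_nat_one_div_lt hε
  filter_upwards [hxu j, hxl j] with n hnu hnl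
  simp only [birkhoffAverage_neg, Pi.neg_apply, integral_neg] at hnl
  rw [Real.dist_eq, abs_lt]
  constructor <;> linarith

variable [NormedSpace ℝ E]

theorem isClosed_ae_tendsto_birkhoffAverage (hT : Ergodic T μ) :
    IsClosed {f : α →₁[μ] E |
      ∀ᵐ x ∂μ, Tendsto (birkhoffAverage ℝ T f · x) atTop (𝓝 (∫ x, f x ∂μ))} := by
  refine isClosed_of_closure_subset fun f hf => ?_
  have happrox (j : ℕ) := Metric.mem_closure_iff.1 hf (1 / ((j : ℝ) + 1)) Nat.one_div_pos_of_nat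
  choose g hg hfg using happrox
  replace hfg (j : ℕ) : ∫ x, ‖f x - g j x‖ ∂μ < 1 / ((j : ℝ) + 1) := by
    simp only [← dist_eq_norm]
    exact (L1.dist_eq_integral_dist f (g j)).symm.trans_lt (hfg j)
  have hfgint (j : ℕ) : Integrable (fun x => f x - g j x) μ :=
    (L1.integrable_coeFn f).sub (L1.integrable_coeFn (g j))
  filter_upwards [ae_all_iff.2 hg,
    ae_all_iff.2 fun j => ae_tendsto_birkhoffAverage_real hT (hfgint j).norm] with x hgx hfgx
  refine tendsto_of_forall_approx fun ε hε => ?_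
  obtain ⟨j, hj⟩ := exists_nat_one_div_lt hε
  refine ⟨_, _, hgx j, ?_, ?_⟩
  · rw [dist_comm]
    exact (dist_integral_le_integral_norm_sub (L1.integrable_coeFn f)
      (L1.integrable_coeFn (g j))).trans_lt ((hfg j).trans hj)
  · filter_upwards [(hfgx j).eventually_lt_const ((hfg j).trans hj)] with n hn
    rw [dist_eq_norm, ← Pi.sub_apply, ← Pi.sub_apply, ← birkhoffAverage_sub]
    exact (norm_birkhoffAverage_le T _ n x).trans_lt hn

/-- **Birkhoff's pointwise ergodic theorem**. -/
theorem ae_tendsto_birkhoffAverage [CompleteSpace E] (hT : Ergodic T μ) {f : α → E}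
    (hf : Integrable f μ) :
    ∀ᵐ x ∂μ, Tendsto (birkhoffAverage ℝ T f · x) atTop (𝓝 (∫ x, f x ∂μ)) := by
  refine Integrable.induction (P := fun f => ∀ᵐ x ∂μ,
    Tendsto (birkhoffAverage ℝ T f · x) atTop (𝓝 (∫ x, f x ∂μ))) ?_ ?_ ?_ ?_ hf
  · intro c s hs _
    filter_upwards [ae_tendsto_birkhoffAverage_real hT
      ((integrable_const (1 : ℝ)).indicator hs)] with x hx
    have havg (n : ℕ) : birkhoffAverage ℝ T (s.indicator fun _ => c) n x =
        birkhoffAverage ℝ T (s.indicator fun _ => (1 : ℝ)) n x • c := by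
      simp only [birkhoffAverage, birkhoffSum, smul_assoc, Finset.sum_smul,
        ← Set.indicator_smul_const_apply, one_smul]
    rw [integral_indicator_const _ hs] at hx ⊢
    simpa only [havg, smul_eq_mul, mul_one] using hx.smul_const c
  · intro f g _ hf hg hfavg hgavg
    filter_upwards [hfavg, hgavg] with x hxf hxg
    simp only [birkhoffAverage_add, Pi.add_apply, integral_add hf hg]
    exact hxf.add hxg
  · exact isClosed_ae_tendsto_birkhoffAverage hT
  · intro f g hfg _ hfavg
    have havg (n : ℕ) := hT.quasiMeasurePreserving.birkhoffAverage_ae_eq_of_ae_eq ℝ hfg n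
    filter_upwards [hfavg, ae_all_iff.2 havg] with x hx hxfg
    simpa only [hxfg, integral_congr_ae hfg] using hx

end Birkhoff

section UniqueErgodicity

variable {α : Type*} [MeasurableSpace α]

/-- The empirical measure of an orbit: the uniform probability measure on the first `n + 1`
points of the orbit of `x`, counted with multiplicity. The shift by one keeps it a probability
measure for every `n`. -/
def empiricalMeasure (T : α → α) (x : α) (n : ℕ) : ProbabilityMeasure α :=
  ⟨((n + 1 : ℕ) : ℝ≥0∞)⁻¹ • ∑ k ∈ Finset.range (n + 1), Measure.dirac (T^[k] x), ⟨by
    simp [ENNReal.inv_mul_cancel]⟩⟩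

theorem integral_empiricalMeasure {E : Type*} [NormedAddCommGroup E] [NormedSpace ℝ E]
    [CompleteSpace E] (T : α → α) (x : α) (n : ℕ) {f : α → E}
    (hf : StronglyMeasurable f) :
    ∫ y, f y ∂(empiricalMeasure T x n : Measure α) = birkhoffAverage ℝ T f (n + 1) x := by
  have hint (y : α) : Integrable f (Measure.dirac y) := integrable_dirac' hf (by simp)
  change ∫ y, f y ∂(((n + 1 : ℕ) : ℝ≥0∞)⁻¹ •
    ∑ k ∈ Finset.range (n + 1), Measure.dirac (T^[k] x)) = _
  rw [integral_smul_measure, integral_finsetSum_measure fun k _ => hint _]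
  simp only [integral_dirac' _ _ hf, ENNReal.toReal_inv, ENNReal.toReal_natCast, birkhoffAverage,
    birkhoffSum]

variable [TopologicalSpace α] [HasOuterApproxClosed α] [BorelSpace α] {T : α → α}

theorem measurePreserving_of_mapClusterPt_empiricalMeasure (hT : Continuous T) {x : α}
    {ρ : ProbabilityMeasure α} (hρ : MapClusterPt ρ atTop (empiricalMeasure T x)) :
    MeasurePreserving T (ρ : Measure α) (ρ : Measure α) := by
  refine ⟨hT.measurable, ?_⟩
  have : IsProbabilityMeasure (Measure.map T (ρ : Measure α)) :=
    Measure.isProbabilityMeasure_map hT.measurable.aemeasurable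
  refine ext_of_forall_integral_eq_of_IsFiniteMeasure fun f => ?_
  rw [integral_map hT.measurable.aemeasurable f.continuous.measurable.aestronglyMeasurable]
  obtain ⟨U, hU, hUρ⟩ := mapClusterPt_iff_ultrafilter.1 hρ
  have hlim (g : BoundedContinuousFunction α ℝ) :
      Tendsto (fun n => birkhoffAverage ℝ T g (n + 1) x) U (𝓝 (∫ y, g y ∂(ρ : Measure α))) := by
    simpa only [integral_empiricalMeasure T x _ g.continuous.measurable.stronglyMeasurable]
      using ProbabilityMeasure.tendsto_iff_forall_integral_tendsto.1 hUρ g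
  have hshift (n : ℕ) : birkhoffAverage ℝ T (f.compContinuous ⟨T, hT⟩) (n + 1) x =
      birkhoffAverage ℝ T f (n + 1) (T x) := by
    simp [birkhoffAverage, birkhoffSum, ← Function.iterate_succ_apply',
      Function.iterate_succ_apply]
  have hdiff : Tendsto (fun n => birkhoffAverage ℝ T f (n + 1) (T x) -
      birkhoffAverage ℝ T f (n + 1) x) U (𝓝 0) :=
    ((tendsto_birkhoffAverage_apply_sub_birkhoffAverage' ℝ f.isBounded_range T x).comp
      (tendsto_add_atTop_nat 1)).mono_left hU
  have hlimT := hlim (f.compContinuous ⟨T, hT⟩)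
  simp only [hshift] at hlimT
  exact sub_eq_zero.1 (tendsto_nhds_unique (hlimT.sub (hlim f)) hdiff)

variable [CompactSpace α] [T2Space α] {ν : Measure α} [IsProbabilityMeasure ν]

theorem IsUniquelyErgodic.tendsto_empiricalMeasure (hT : IsUniquelyErgodic T ν) (x : α) :
    Tendsto (empiricalMeasure T x) atTop (𝓝 ⟨ν, inferInstance⟩) :=
  le_nhds_of_unique_clusterPt fun ρ hρ => Subtype.ext <|
    hT.eq_of_invariant ρ inferInstance
      (measurePreserving_of_mapClusterPt_empiricalMeasure hT.continuous hρ)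

theorem IsUniquelyErgodic.tendsto_birkhoffAverage {𝕜 : Type*} [RCLike 𝕜]
    (hT : IsUniquelyErgodic T ν) {f : α → 𝕜} (hf : Continuous f) (x : α) :
    Tendsto (birkhoffAverage ℝ T f · x) atTop (𝓝 (∫ y, f y ∂ν)) := by
  have hlim := (ProbabilityMeasure.tendsto_iff_forall_integral_rclike_tendsto 𝕜).1
    (hT.tendsto_empiricalMeasure x) (.mkOfCompact ⟨f, hf⟩)
  simp only [BoundedContinuousFunction.mkOfCompact_apply, ContinuousMap.coe_mk,
    integral_empiricalMeasure T x _ hf.measurable.stronglyMeasurable] at hlim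
  exact (tendsto_add_atTop_iff_nat 1).1 hlim

end UniqueErgodicity

section WeakConvergence

variable {X ι 𝕜 : Type*} [RCLike 𝕜] [TopologicalSpace X] [CompactSpace X] [MeasurableSpace X]
  [OpensMeasurableSpace X] {l : Filter ι} {μs : ι → FiniteMeasure X} {μ : FiniteMeasure X}

theorem integrable_continuousMap (μ : FiniteMeasure X) (f : C(X, 𝕜)) :
    Integrable f (μ : Measure X) :=
  (BoundedContinuousFunction.mkOfCompact f).integrable _

theorem norm_integral_sub_integral_le (μ : FiniteMeasure X) (f g : C(X, 𝕜)) :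
    ‖∫ x, f x ∂(μ : Measure X) - ∫ x, g x ∂(μ : Measure X)‖ ≤ ‖f - g‖ * μ.mass := by
  rw [← integral_sub (integrable_continuousMap μ f) (integrable_continuousMap μ g)]
  exact norm_integral_le_of_norm_le_const (.of_forall (f - g).norm_coe_le_norm)

theorem tendsto_integral_of_mem_span {S : Set C(X, 𝕜)}
    (h : ∀ f ∈ S, Tendsto (fun i => ∫ x, f x ∂(μs i : Measure X)) l
      (𝓝 (∫ x, f x ∂(μ : Measure X)))) {f : C(X, 𝕜)} (hf : f ∈ Submodule.span 𝕜 S) :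
    Tendsto (fun i => ∫ x, f x ∂(μs i : Measure X)) l (𝓝 (∫ x, f x ∂(μ : Measure X))) := by
  induction hf using Submodule.span_induction with
  | mem f hf => exact h f hf
  | zero => simpa using tendsto_const_nhds
  | add f g _ _ hf hg =>
    simpa only [ContinuousMap.add_apply,
      integral_add (integrable_continuousMap _ f) (integrable_continuousMap _ g)] using hf.add hg
  | smul c f _ hf =>
    simpa only [ContinuousMap.smul_apply, integral_smul] using hf.const_smul c

theorem tendsto_finiteMeasure_of_dense_span {S : Set C(X, 𝕜)}
    (hS : Dense (Submodule.span 𝕜 S : Set C(X, 𝕜))) {C : ℝ}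
    (hC : ∀ᶠ i in l, ((μs i).mass : ℝ) ≤ C)
    (h : ∀ f ∈ S, Tendsto (fun i => ∫ x, f x ∂(μs i : Measure X)) l
      (𝓝 (∫ x, f x ∂(μ : Measure X)))) :
    Tendsto μs l (𝓝 μ) := by
  refine (FiniteMeasure.tendsto_iff_forall_integral_rclike_tendsto 𝕜).2 fun f =>
    tendsto_of_forall_approx fun ε hε => ?_
  set K : ℝ := max C μ.mass
  have hK : 0 < K + 1 := by linarith [le_max_right C μ.mass, μ.mass.coe_nonneg]
  obtain ⟨g, hg, hfg⟩ := hS.exists_dist_lt f.toContinuousMap (div_pos hε hK)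
  rw [dist_eq_norm, lt_div_iff₀ hK] at hfg
  have hdist (ρ : FiniteMeasure X) (hρ : (ρ.mass : ℝ) ≤ K) :
      dist (∫ x, f x ∂(ρ : Measure X)) (∫ x, g x ∂(ρ : Measure X)) < ε := calc
    _ = ‖∫ x, f x ∂(ρ : Measure X) - ∫ x, g x ∂(ρ : Measure X)‖ := dist_eq_norm _ _
    _ ≤ ‖f.toContinuousMap - g‖ * ρ.mass := norm_integral_sub_integral_le ρ f.toContinuousMap g
    _ ≤ ‖f.toContinuousMap - g‖ * (K + 1) := by gcongr; linarith
    _ < ε := hfg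
  refine ⟨_, _, tendsto_integral_of_mem_span h hg, ?_, ?_⟩
  · rw [dist_comm]
    exact hdist μ (le_max_right _ _)
  · filter_upwards [hC] with i hi
    exact hdist (μs i) (hi.trans (le_max_left _ _))

end WeakConvergence

section Circle

variable {p : ℝ}

theorem integral_fourier_neg (μ : Measure (AddCircle p)) (n : ℤ) :
    ∫ x, fourier (-n) x ∂μ = starRingEnd ℂ (∫ x, fourier n x ∂μ) := by
  simp only [fourier_neg, integral_conj]

theorem norm_integral_fourier_zero (μ : FiniteMeasure (AddCircle p)) :
    ‖∫ x, fourier 0 x ∂(μ : Measure (AddCircle p))‖ = μ.mass := by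
  simp only [fourier_zero, integral_const, norm_smul, norm_one, mul_one,
    Real.norm_of_nonneg measureReal_nonneg]
  rfl

theorem norm_sq_sum_fourier_mul (s : Finset ℕ) (a : ℕ → ℂ) (x : AddCircle p) :
    (‖∑ k ∈ s, fourier (k : ℤ) x * a k‖ : ℂ) ^ 2 =
      ∑ kl ∈ s ×ˢ s, a kl.1 * starRingEnd ℂ (a kl.2) * fourier ((kl.1 : ℤ) - kl.2) x := by
  rw [← Complex.mul_conj', map_sum, Finset.sum_mul_sum, ← Finset.sum_product']
  refine Finset.sum_congr rfl fun kl _ => ?_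
  rw [map_mul, ← fourier_neg, sub_eq_add_neg, fourier_add]
  ring

variable [Fact (0 < p)] {ι : Type*} {l : Filter ι} {μs : ι → FiniteMeasure (AddCircle p)}
  {μ : FiniteMeasure (AddCircle p)}

theorem tendsto_finiteMeasure_of_tendsto_integral_fourier
    (h : ∀ n : ℤ, Tendsto (fun i => ∫ x, fourier n x ∂(μs i : Measure (AddCircle p))) l
      (𝓝 (∫ x, fourier n x ∂(μ : Measure (AddCircle p))))) :
    Tendsto μs l (𝓝 μ) := by
  have hmass : Tendsto (fun i => ((μs i).mass : ℝ)) l (𝓝 μ.mass) := by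
    simpa only [norm_integral_fourier_zero] using (h 0).norm
  exact tendsto_finiteMeasure_of_dense_span
    (Submodule.dense_iff_topologicalClosure_eq_top.2 span_fourier_closure_eq_top)
    (hmass.eventually_le_const (lt_add_one _)) (Set.forall_mem_range.2 h)

theorem tendsto_finiteMeasure_of_tendsto_integral_fourier_neg_nat
    (h : ∀ m : ℕ, Tendsto (fun i => ∫ x, fourier (-(m : ℤ)) x ∂(μs i : Measure (AddCircle p))) l
      (𝓝 (∫ x, fourier (-(m : ℤ)) x ∂(μ : Measure (AddCircle p))))) :
    Tendsto μs l (𝓝 μ) := by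
  refine tendsto_finiteMeasure_of_tendsto_integral_fourier fun n => ?_
  obtain ⟨m, rfl | rfl⟩ := n.eq_nat_or_neg
  · simpa only [Function.comp_def, integral_fourier_neg, starRingEnd_self_apply] using
      (Complex.continuous_conj.tendsto _).comp (h m)
  · exact h m

theorem fourierCoeff_norm_sq_sum_fourier_mul (s : Finset ℕ) (a : ℕ → ℂ) (m : ℕ) :
    fourierCoeff (fun x : AddCircle p => (‖∑ k ∈ s, fourier (k : ℤ) x * a k‖ : ℂ) ^ 2) m =
      ∑ l ∈ s with m + l ∈ s, a (m + l) * starRingEnd ℂ (a l) := by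
  have hexpand : (fun x : AddCircle p => (‖∑ k ∈ s, fourier (k : ℤ) x * a k‖ : ℂ) ^ 2) =
      ∑ kl ∈ s ×ˢ s, fun x => a kl.1 * starRingEnd ℂ (a kl.2) * fourier ((kl.1 : ℤ) - kl.2) x := by
    ext x
    rw [norm_sq_sum_fourier_mul, Finset.sum_apply]
  have hint (c : ℂ) (n : ℤ) :
      Integrable (fun x : AddCircle p => c * fourier n x) AddCircle.haarAddCircle :=
    (by fun_prop : Continuous _).integrable_of_hasCompactSupport (.of_compactSpace _)
  have hcoeff (k l : ℕ) : fourierCoeff (fun x : AddCircle p =>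
      a k * starRingEnd ℂ (a l) * fourier ((k : ℤ) - l) x) m =
        if k = m + l then a k * starRingEnd ℂ (a l) else 0 := by
    rw [fourierCoeff.const_mul, fourierCoeff_fourier, Pi.single_apply, mul_ite, mul_one, mul_zero]
    exact if_congr (by omega) rfl rfl
  rw [hexpand, fourierCoeff.sum _ _ fun kl _ => hint _ _, Finset.sum_apply,
    Finset.sum_product_right]
  simp only [hcoeff, Finset.sum_ite_eq', Finset.sum_filter]

end Circle

section Periodogram

variable {Ω : Type*}

/-- The lag-`m` product `y ↦ ψ(T^m y) · conj ψ(y)`, whose Birkhoff averages are the empirical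
autocorrelations of `ψ` along an orbit. -/
def lagProduct (T : Ω → Ω) (ψ : Ω → ℂ) (m : ℕ) (y : Ω) : ℂ :=
  ψ (T^[m] y) * starRingEnd ℂ (ψ y)

theorem integral_periodogram (T : Ω → Ω) (ψ : Ω → ℂ) (ω : Ω) (n : ℕ) (g : UnitAddCircle → ℂ) :
    ∫ x, g x ∂(periodogram T ψ ω n : Measure UnitAddCircle) =
      (n : ℂ)⁻¹ * ∫ x, g x * (‖twistedSum T ψ ω n x‖ : ℂ) ^ 2 := by
  have hdensity : Measurable fun x => ENNReal.ofReal ((n : ℝ)⁻¹ * ‖twistedSum T ψ ω n x‖ ^ 2) :=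
    (((continuous_twistedSum T ψ ω n).norm.pow 2).const_mul _).measurable.ennreal_ofReal
  change ∫ x, g x ∂(volume.withDensity _) = _
  rw [integral_withDensity_eq_integral_toReal_smul hdensity
    (.of_forall fun _ => ENNReal.ofReal_lt_top), ← integral_const_mul]
  refine integral_congr_ae (.of_forall fun x => ?_)
  simp only [ENNReal.toReal_ofReal (by positivity : 0 ≤ (n : ℝ)⁻¹ * ‖twistedSum T ψ ω n x‖ ^ 2),
    Complex.real_smul]
  push_cast
  ring

theorem integral_fourier_periodogram (T : Ω → Ω) (ψ : Ω → ℂ) (ω : Ω) (n m : ℕ) :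
    ∫ x, fourier (-(m : ℤ)) x ∂(periodogram T ψ ω n : Measure UnitAddCircle) =
      (n : ℂ)⁻¹ * birkhoffSum T (lagProduct T ψ m) (n - m) ω := by
  have hcoeff := fourierCoeff_norm_sq_sum_fourier_mul (p := 1) (Finset.range n)
    (fun k => ψ (T^[k] ω)) m
  rw [fourierCoeff, AddCircle.integral_haarAddCircle, inv_one, one_smul] at hcoeff
  have hrange : {l ∈ Finset.range n | m + l ∈ Finset.range n} = Finset.range (n - m) := by
    ext l
    simp only [Finset.mem_filter, Finset.mem_range]
    omega
  simp only [hrange, Function.iterate_add_apply] at hcoeff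
  rw [integral_periodogram]
  exact congrArg _ hcoeff

theorem tendsto_integral_fourier_periodogram {T : Ω → Ω} {ψ : Ω → ℂ} {ω : Ω} {m : ℕ} {c : ℂ}
    (h : Tendsto (birkhoffAverage ℝ T (lagProduct T ψ m) · ω) atTop (𝓝 c)) :
    Tendsto (fun n => ∫ x, fourier (-(m : ℤ)) x ∂(periodogram T ψ ω n : Measure UnitAddCircle))
      atTop (𝓝 c) := by
  rw [← tendsto_add_atTop_iff_nat m]
  have hratio : Tendsto (fun n : ℕ => (n : ℂ) / (n + m : ℂ)) atTop (𝓝 1) :=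
    tendsto_natCast_div_add_atTop (m : ℂ)
  have hprod := hratio.mul h
  rw [one_mul] at hprod
  refine hprod.congr' ?_
  filter_upwards [eventually_ne_atTop 0] with n hn
  have hn' : (n : ℂ) ≠ 0 := Nat.cast_ne_zero.2 hn
  rw [integral_fourier_periodogram, Nat.add_sub_cancel, birkhoffAverage, Complex.real_smul]
  push_cast
  field_simp

theorem tendsto_periodogram_of_tendsto_birkhoffAverage {T : Ω → Ω} {ψ : Ω → ℂ} {ω : Ω}
    {μ : FiniteMeasure UnitAddCircle}
    (h : ∀ m : ℕ, Tendsto (birkhoffAverage ℝ T (lagProduct T ψ m) · ω) atTop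
      (𝓝 (∫ x, fourier (-(m : ℤ)) x ∂(μ : Measure UnitAddCircle)))) :
    Tendsto (periodogram T ψ ω) atTop (𝓝 μ) :=
  tendsto_finiteMeasure_of_tendsto_integral_fourier_neg_nat fun m =>
    tendsto_integral_fourier_periodogram (h m)

end Periodogram

section Koopman

variable {Ω : Type*} [MeasurableSpace Ω] {ν : Measure Ω} {ψ : Ω → ℂ}

theorem integrable_lagProduct {T : Ω → Ω} (hT : MeasurePreserving T ν ν) (hψ : MemLp ψ 2 ν)
    (m : ℕ) : Integrable (lagProduct T ψ m) ν :=
  (hψ.comp_measurePreserving (hT.iterate m)).integrable_mul hψ.star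

theorem coeFn_koopman_pow (T : Ω ≃ᵐ Ω) (hT : MeasurePreserving T ν ν) (m : ℕ)
    (φ : Lp ℂ 2 ν) : (koopman T ν hT ^ m) φ =ᵐ[ν] φ ∘ T^[m] := by
  induction m with
  | zero => rfl
  | succ m ih =>
    rw [pow_succ', Function.iterate_succ]
    exact (Lp.coeFn_compMeasurePreserving _ hT).trans (hT.quasiMeasurePreserving.ae_eq_comp ih)

theorem integral_fourier_spectralMeasure (T : Ω ≃ᵐ Ω) (hT : MeasurePreserving T ν ν)
    (hψ : MemLp ψ 2 ν) (m : ℕ) :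
    ∫ x, fourier (-(m : ℤ)) x
        ∂(spectralMeasure (koopman T ν hT) (hψ.toLp ψ) : Measure UnitAddCircle) =
      ∫ y, lagProduct T ψ m y ∂ν := by
  rw [isSpectralMeasure_spectralMeasure, zpow_natCast, L2.inner_def]
  refine integral_congr_ae ?_
  filter_upwards [coeFn_koopman_pow T hT m (hψ.toLp ψ), hψ.coeFn_toLp,
    (hT.iterate m).quasiMeasurePreserving.ae_eq_comp hψ.coeFn_toLp] with y hpow hψy hψTy
  rw [hpow, hψTy, hψy]
  rfl

end Koopman

end TwistedWalk

open TwistedWalk in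
theorem lemma4p4_general {Ω : Type*} [MeasurableSpace Ω] (T : Ω ≃ᵐ Ω) (ν : Measure Ω)
    [IsProbabilityMeasure ν] (hT : MeasurePreserving T ν ν) (ψ : Ω → ℂ) (hψ : MemLp ψ 2 ν) :
    (Ergodic T ν → ∀ᵐ ω ∂ν, Tendsto (periodogram T ψ ω) atTop
      (𝓝 (spectralMeasure (koopman T ν hT) (hψ.toLp ψ)))) ∧
    (∀ [TopologicalSpace Ω] [CompactSpace Ω] [T2Space Ω] [HasOuterApproxClosed Ω] [BorelSpace Ω],
      IsUniquelyErgodic T ν → Continuous ψ → ∀ ω, Tendsto (periodogram T ψ ω) atTop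
        (𝓝 (spectralMeasure (koopman T ν hT) (hψ.toLp ψ)))) := by
  refine ⟨fun herg => ?_, fun huniq hcont ω => ?_⟩
  · filter_upwards [ae_all_iff.2 fun m =>
      ae_tendsto_birkhoffAverage herg (integrable_lagProduct hT hψ m)] with ω hω
    refine tendsto_periodogram_of_tendsto_birkhoffAverage fun m => ?_
    exact (integral_fourier_spectralMeasure T hT hψ m).symm ▸ hω m
  · refine tendsto_periodogram_of_tendsto_birkhoffAverage fun m => ?_
    rw [integral_fourier_spectralMeasure]
    exact huniq.tendsto_birkhoffAverage
      ((hcont.comp (huniq.continuous.iterate m)).mul hcont.star) ω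

end

theorem lemma4p4 {Ω : Type*} [MetricSpace Ω] [CompactSpace Ω] [MeasurableSpace Ω] [BorelSpace Ω]
    (T : Ω ≃ᵐ Ω) (ν : Measure Ω) [IsProbabilityMeasure ν] (hT : Ergodic T ν)
    (ψ : Ω → ℂ) (hψ : MemLp ψ 2 ν) :
    (∀ᵐ ω ∂ν, Tendsto (fun n : ℕ => TwistedWalk.periodogram T ψ ω n) atTop
      (𝓝 (TwistedWalk.spectralMeasure
        (TwistedWalk.koopman T ν hT.toMeasurePreserving) (hψ.toLp ψ)))) ∧
    (TwistedWalk.IsUniquelyErgodic T ν → Continuous ψ →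
      ∀ ω : Ω, Tendsto (fun n : ℕ => TwistedWalk.periodogram T ψ ω n) atTop
        (𝓝 (TwistedWalk.spectralMeasure
          (TwistedWalk.koopman T ν hT.toMeasurePreserving) (hψ.toLp ψ)))) := by
  obtain ⟨hergodic, hunique⟩ := lemma4p4_general T ν hT.toMeasurePreserving ψ hψ
  exact ⟨hergodic hT, hunique⟩
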